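/- Let $\mathcal Z$ be a complex Hilbert space and let $A:D(A)\subset\mathcal Z\to\mathcal Z$ be skew-adjoint, i.e. densely defined with $A^*=-A$. Assume that the spectrum $\sigma(A)$ is non-empty, has no finite accumulation point, and consists of eigenvalues of finite algebraic multiplicity. Let $b\in\mathcal Z$, $b\neq 0$, let $Bu=bu$ for $u\in\mathbb C$, so that $B^*x=\langle x,b\rangle$, and consider the collocated skew-adjoint system $\Sigma(A,B,B^*)$: $\dot x=Ax+Bu$, $y=B^*x$. Its invariant zeros are the $\mu\in\mathbb C$ for which there are $x\in D(A)\setminus\{0\}$ and $u\in\mathbb C$ with $(\mu I-A)x-bu=0$ and $\langle x,b\rangle=0$. Assume that the system is minimal, i.e. no invariant zero lies in $\sigma(A)$, and that $b\in D((-A)^{1/2})$, where $(-A)^{1/2}$ is the (Balakrishnan) fractional power, i.e. the closure of the operator $$x\mapsto \frac1\pi\int_0^\infty s^{-1/2}(sI-A)^{-1}(-A)x\,ds,\qquad x\in D(A).$$ Then: 1. The set of invariant zeros is countable. If it is infinite and $\{\mu_n\}_{n\in\mathbb N}$ is any enumeration of it without repetition, then for every $\varepsilon>0$ there is $N\in\mathbb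 N$ such that for every $n\ge N$ one has $|\mu_n-\lambda|<\varepsilon$ for some eigenvalue $\lambda$ of $A$. 2. Every invariant zero $\mu$ lies in the resolvent set of $A$, and the normalized vectors $\|(\mu I-A)^{-1}b\|^{-1}(\mu I-A)^{-1}b$, with $\mu$ running through the invariant zeros, form an orthonormal system. -/

import Mathlib

/-!
# Single-input single-output systems on a complex Hilbert space

An unbounded operator is a partially defined linear map `A : Z →ₗ.[ℂ] Z` with domain `A.domain`.
-/

namespace CollocatedSystems

noncomputable section

variable {Z : Type*} [NormedAddCommGroup Z] [InnerProductSpace ℂ Z]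

/-- The operator `s I - A`, defined on the domain of `A`. -/
def shift (A : Z →ₗ.[ℂ] Z) (s : ℂ) : A.domain →ₗ[ℂ] Z :=
  s • A.domain.subtype - A.toFun

/-- `R` is a bounded, everywhere defined, two-sided inverse of `s I - A`. -/
def IsResolventAt (A : Z →ₗ.[ℂ] Z) (s : ℂ) (R : Z →L[ℂ] Z) : Prop :=
  (∀ x : A.domain, R (shift A s x) = x) ∧
    ∀ z : Z, ∃ x : A.domain, (x : Z) = R z ∧ shift A s x = z

/-- The resolvent set of `A`. -/
def resolventSet (A : Z →ₗ.[ℂ] Z) : Set ℂ :=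
  {s | ∃ R : Z →L[ℂ] Z, IsResolventAt A s R}

/-- The spectrum of `A`. -/
def spec (A : Z →ₗ.[ℂ] Z) : Set ℂ := (resolventSet A)ᶜ

open Classical in
/-- The resolvent operator `(s I - A)⁻¹` for `s` in the resolvent set (and `0` elsewhere). -/
def resolventOp (A : Z →ₗ.[ℂ] Z) (s : ℂ) : Z →L[ℂ] Z :=
  if h : ∃ R : Z →L[ℂ] Z, IsResolventAt A s R then h.choose else 0

/-- The inverse in the definition of the resolvent set is unique, so `resolventOp` is *the*
inverse. -/
theorem IsResolventAt.eq_resolventOp {A : Z →ₗ.[ℂ] Z} {s : ℂ} {R : Z →L[ℂ] Z}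
    (h : IsResolventAt A s R) : R = resolventOp A s := by
  have hex : ∃ R : Z →L[ℂ] Z, IsResolventAt A s R := ⟨R, h⟩
  have hr : resolventOp A s = hex.choose := by simp only [resolventOp, dif_pos hex]
  rw [hr]
  ext z
  obtain ⟨x, hx, hxz⟩ := h.2 z
  rw [← hx, ← hxz, hex.choose_spec.1 x]

/-- `l` is an eigenvalue of `A`. -/
def IsEigenvalue (A : Z →ₗ.[ℂ] Z) (l : ℂ) : Prop :=
  ∃ x : A.domain, (x : Z) ≠ 0 ∧ A x = l • (x : Z)

/-- The kernel of `(l I - A) ^ n`. -/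
def genKer (A : Z →ₗ.[ℂ] Z) (l : ℂ) : ℕ → Submodule ℂ Z
  | 0 => ⊥
  | n + 1 => ((genKer A l n).comap (shift A l)).map A.domain.subtype

/-- The root space of `A` at `l`; its dimension is the algebraic multiplicity of `l`. -/
def rootSpace (A : Z →ₗ.[ℂ] Z) (l : ℂ) : Submodule ℂ Z := ⨆ n, genKer A l n

/-- The spectrum of `A` is nonempty, has no finite accumulation point, and consists of
eigenvalues of finite algebraic multiplicity. -/
structure HasDiscreteSpectrum (A : Z →ₗ.[ℂ] Z) : Prop where
  nonempty : (spec A).Nonempty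
  not_accPt : ∀ s : ℂ, ¬ AccPt s (Filter.principal (spec A))
  eigenvalue : ∀ l ∈ spec A, IsEigenvalue A l
  finite_mult : ∀ l ∈ spec A, FiniteDimensional ℂ (rootSpace A l)

/-- `A` is skew-adjoint: densely defined with `A* = -A` (equality of domains included). -/
def IsSkewAdjoint [CompleteSpace Z] (A : Z →ₗ.[ℂ] Z) : Prop :=
  Dense (A.domain : Set Z) ∧ A.adjoint = -A

/-- The Balakrishnan integral
`(sin (π α) / π) ∫₀^∞ s ^ (α - 1) (s I - A)⁻¹ (-A) x ds`, for `x` in the domain of `A`. -/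
def balakrishnan (A : Z →ₗ.[ℂ] Z) (α : ℝ) (x : A.domain) : Z :=
  ((Real.sin (Real.pi * α) / Real.pi : ℝ) : ℂ) •
    ∫ s in Set.Ioi (0 : ℝ), ((s ^ (α - 1) : ℝ) : ℂ) • resolventOp A (s : ℂ) (-(A x))

/-- The graph of the fractional power `(-A) ^ α`, `0 < α < 1`: the closure of the graph of the
Balakrishnan integral on the domain of `A`. -/
def fracPowGraph (A : Z →ₗ.[ℂ] Z) (α : ℝ) : Set (Z × Z) :=
  closure (Set.range fun x : A.domain => ((x : Z), balakrishnan A α x))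

/-- The domain of the fractional power `(-A) ^ α`, `0 < α < 1`. -/
def fracPowDomain (A : Z →ₗ.[ℂ] Z) (α : ℝ) : Set Z :=
  {z | ∃ y : Z, (z, y) ∈ fracPowGraph A α}

variable (Z) in
/-- The data of a system `x' = A x + B u`, `y = C x + D u` with scalar input and output. -/
structure ControlSystem where
  A : Z →ₗ.[ℂ] Z
  B : ℂ →L[ℂ] Z
  C : Z →L[ℂ] ℂ
  D : ℂ

/-- The invariant zeros: those `l` for which `(l I - A) x - B u = 0`, `C x + D u = 0` for some
scalar `u` and some nonzero `x` in the domain of `A`. -/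
def ControlSystem.invariantZeros (S : ControlSystem Z) : Set ℂ :=
  {l | ∃ (x : S.A.domain) (u : ℂ), (x : Z) ≠ 0 ∧
    shift S.A l x - S.B u = 0 ∧ S.C x + S.D * u = 0}

/-- A system is minimal if no invariant zero lies in the spectrum of `A`. -/
def ControlSystem.IsMinimal (S : ControlSystem Z) : Prop :=
  S.invariantZeros ∩ spec S.A = ∅

/-- The collocated system `Σ(A, B, B*)` with `B u = u b` and `D = 0`. -/
def collocated [CompleteSpace Z] (A : Z →ₗ.[ℂ] Z) (b : Z) : ControlSystem Z where
  A := A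
  B := ContinuousLinearMap.toSpanSingleton ℂ b
  C := ContinuousLinearMap.adjoint (ContinuousLinearMap.toSpanSingleton ℂ b)
  D := 0

end

end CollocatedSystems

/-! Write R(s) = (sI - A)⁻¹. By minimality an invariant zero μ lies in the resolvent set, its state
vector is a multiple of R(μ)b, and the output condition becomes ⟨b, R(μ)b⟩ = 0. Skew-symmetry then
puts μ on the imaginary axis and makes R(μ)b ⊥ R(ν)b for distinct zeros. Since s ↦ R(s)b is
continuous, this orthogonality also forbids zeros to accumulate at a point of the resolvent set
(`not_accPt_zeros`).

For the asymptotics, b = Σ w_l is expanded in eigenvectors of A; completeness comes from the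
functional calculus of the normal operator (I - A)⁻¹. At a zero, expanding μ⟨b, R(μ)b⟩ - ‖b‖² gives
Σ l‖w_l‖²/(μ - l) = -‖b‖² (`hasSum_eigenvalue_mul_inner`). The fractional domain condition yields Σ
|l|‖w_l‖² < ∞. If zeros at distance at least ε from all eigenvalues were unbounded, dominated
convergence would force b = 0. So these zeros are bounded and without accumulation point, hence
finite in number; countability follows by taking ε = 1/(n+1). -/

open CollocatedSystems Filter Topology
open scoped InnerProductSpace

/-! ### Resolvent calculus -/

section
variable {Z : Type*} [NormedAddCommGroup Z] [InnerProductSpace ℂ Z]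

/-- `A` is skew-symmetric on its domain. -/
def IsSkewSymmetric (A : Z →ₗ.[ℂ] Z) : Prop :=
  ∀ x y : A.domain, ⟪A x, (y : Z)⟫_ℂ = -⟪(x : Z), A y⟫_ℂ

theorem CollocatedSystems.IsSkewAdjoint.isSkewSymmetric [CompleteSpace Z] {A : Z →ₗ.[ℂ] Z}
    (hA : IsSkewAdjoint A) : IsSkewSymmetric A := by
  intro x y
  -- Stated existentially, so that `A.adjoint = -A` can be rewritten although the domain depends on
  -- the operator.
  have key : ∀ x : A.domain, ∃ x' : A.adjoint.domain, (x' : Z) = x ∧ A.adjoint x' = -A x := by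
    rw [hA.2]
    exact fun x => ⟨x, rfl, rfl⟩
  obtain ⟨x', hx, hx'⟩ := key x
  have := LinearPMap.adjoint_isFormalAdjoint hA.1 x' y
  rw [hx, hx', inner_neg_left] at this
  rw [← this, neg_neg]

theorem shift_apply (A : Z →ₗ.[ℂ] Z) (s : ℂ) (x : A.domain) :
    shift A s x = s • (x : Z) - A x := rfl

theorem isResolventAt_resolventOp {A : Z →ₗ.[ℂ] Z} {s : ℂ} (hs : s ∈ resolventSet A) :
    IsResolventAt A s (resolventOp A s) := by
  obtain ⟨R, hR⟩ := hs
  rwa [← hR.eq_resolventOp]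

/-- The resolvent as a vector of the domain. -/
theorem exists_resolventOp_eq {A : Z →ₗ.[ℂ] Z} {s : ℂ} (hs : s ∈ resolventSet A) (z : Z) :
    ∃ x : A.domain, (x : Z) = resolventOp A s z ∧ A x = s • (x : Z) - z := by
  obtain ⟨x, hx, hxz⟩ := (isResolventAt_resolventOp hs).2 z
  exact ⟨x, hx, by rw [← hxz, shift_apply]; abel⟩

theorem resolventOp_eq_of_shift_eq {A : Z →ₗ.[ℂ] Z} {s : ℂ} (hs : s ∈ resolventSet A)
    {x : A.domain} {z : Z} (h : shift A s x = z) : resolventOp A s z = x := by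
  rw [← h, (isResolventAt_resolventOp hs).1 x]

theorem resolventOp_eq_zero_iff {A : Z →ₗ.[ℂ] Z} {s : ℂ} (hs : s ∈ resolventSet A) {z : Z} :
    resolventOp A s z = 0 ↔ z = 0 := by
  refine ⟨fun h => ?_, fun h => by rw [h, map_zero]⟩
  obtain ⟨x, hx, hxz⟩ := exists_resolventOp_eq hs z
  rw [h] at hx
  have h0 : x = 0 := Subtype.ext hx
  rw [h0] at hxz
  simpa using hxz

theorem CollocatedSystems.IsEigenvalue.mem_spec {A : Z →ₗ.[ℂ] Z} {l : ℂ} (h : IsEigenvalue A l) : l ∈ spec A := by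
  intro hl
  obtain ⟨x, hx, hxl⟩ := h
  refine hx ?_
  rw [← (isResolventAt_resolventOp hl).1 x, shift_apply, hxl, sub_self, map_zero]

/-- The resolvent identity. -/
theorem resolventOp_sub {A : Z →ₗ.[ℂ] Z} {s t : ℂ} (hs : s ∈ resolventSet A)
    (ht : t ∈ resolventSet A) (z : Z) :
    resolventOp A s z - resolventOp A t z = (t - s) • resolventOp A s (resolventOp A t z) := by
  obtain ⟨x, hx, hxz⟩ := exists_resolventOp_eq ht z
  have h : resolventOp A s ((s - t) • resolventOp A t z + z) = x := by
    refine resolventOp_eq_of_shift_eq hs ?_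
    rw [shift_apply, hxz, ← hx, sub_smul]
    abel
  rw [map_add, map_smul, hx] at h
  conv_lhs => rw [← h]
  module

theorem resolventOp_comm {A : Z →ₗ.[ℂ] Z} {s t : ℂ} (hs : s ∈ resolventSet A)
    (ht : t ∈ resolventSet A) (z : Z) :
    resolventOp A s (resolventOp A t z) = resolventOp A t (resolventOp A s z) := by
  rcases eq_or_ne s t with rfl | hst
  · rfl
  have h1 := resolventOp_sub hs ht z
  have h2 := resolventOp_sub ht hs z
  have h3 : (t - s) • resolventOp A s (resolventOp A t z)
      = (t - s) • resolventOp A t (resolventOp A s z) := by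
    rw [← h1, ← neg_sub, h2]
    module
  exact smul_right_injective _ (sub_ne_zero.2 hst.symm) h3

/-- By the resolvent identity the increment is at most ‖s - p‖ K ‖R(s)z‖, and once ‖s - p‖ K < 1/2
this forces ‖R(s)z‖ ≤ 2‖R(p)z‖. -/
theorem continuousOn_resolventOp (A : Z →ₗ.[ℂ] Z) (z : Z) :
    ContinuousOn (fun s => resolventOp A s z) (resolventSet A) := by
  intro p hp
  set K := ‖resolventOp A p‖ with hK
  have hK0 : 0 ≤ K := norm_nonneg _
  have hsub : ∀ s ∈ resolventSet A,
      ‖resolventOp A s z - resolventOp A p z‖ ≤ ‖s - p‖ * (K * ‖resolventOp A s z‖) := by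
    intro s hs
    rw [resolventOp_sub hs hp z, resolventOp_comm hs hp, norm_smul, norm_sub_rev]
    gcongr
    exact (resolventOp A p).le_opNorm _
  have hsmall : ∀ᶠ s in 𝓝[resolventSet A] p, ‖s - p‖ * K < 1 / 2 := by
    have hc : ContinuousAt (fun s : ℂ => ‖s - p‖ * K) p := by fun_prop
    refine (hc.eventually_lt_const ?_).filter_mono nhdsWithin_le_nhds
    simp
  have hbd : ∀ᶠ s in 𝓝[resolventSet A] p,
      ‖resolventOp A s z - resolventOp A p z‖ ≤ ‖s - p‖ * (K * (2 * ‖resolventOp A p z‖)) := by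
    filter_upwards [hsmall, self_mem_nhdsWithin] with s h1 hs
    have h2 := hsub s hs
    refine h2.trans ?_
    gcongr
    have h3 : ‖resolventOp A s z‖
        ≤ ‖resolventOp A s z - resolventOp A p z‖ + ‖resolventOp A p z‖ := by
      simpa using norm_add_le (resolventOp A s z - resolventOp A p z) (resolventOp A p z)
    have h4 : ‖s - p‖ * (K * ‖resolventOp A s z‖) ≤ 1 / 2 * ‖resolventOp A s z‖ := by
      rw [← mul_assoc]
      gcongr
    linarith
  rw [ContinuousWithinAt, tendsto_iff_norm_sub_tendsto_zero]
  refine squeeze_zero' (Eventually.of_forall fun _ => norm_nonneg _) hbd ?_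
  have hc : ContinuousAt (fun s : ℂ => ‖s - p‖ * (K * (2 * ‖resolventOp A p z‖))) p := by
    fun_prop
  simpa [ContinuousAt] using hc.tendsto.mono_left (nhdsWithin_le_nhds (s := resolventSet A))

/-! ### Skew-symmetric operators -/

section Skew
variable {A : Z →ₗ.[ℂ] Z}

theorem IsSkewSymmetric.re_inner_self (hA : IsSkewSymmetric A) (x : A.domain) :
    (⟪(x : Z), A x⟫_ℂ).re = 0 := by
  have h := hA x x
  rw [← inner_conj_symm] at h
  have h' := congrArg Complex.re h
  simp only [Complex.conj_re, Complex.neg_re] at h'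
  linarith

theorem IsSkewSymmetric.re_eigenvalue (hA : IsSkewSymmetric A) {l : ℂ} {x : A.domain}
    (hx : (x : Z) ≠ 0) (h : A x = l • (x : Z)) : l.re = 0 := by
  have h1 := hA.re_inner_self x
  rw [h, inner_smul_right, inner_self_eq_norm_sq_to_K] at h1
  have h2 : ((‖(x : Z)‖ : ℂ) ^ 2) = ((‖(x : Z)‖ ^ 2 : ℝ) : ℂ) := by push_cast; rfl
  simp only [Complex.coe_algebraMap, h2, Complex.re_mul_ofReal] at h1
  simpa [hx] using h1

theorem IsSkewSymmetric.mem_resolventSet (hA : IsSkewSymmetric A) (hspec : HasDiscreteSpectrum A)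
    {s : ℂ} (hs : s.re ≠ 0) : s ∈ resolventSet A := by
  by_contra h
  obtain ⟨x, hx, hl⟩ := hspec.eigenvalue s h
  exact hs (hA.re_eigenvalue hx hl)

theorem IsSkewSymmetric.inner_eigenvector (hA : IsSkewSymmetric A) {l : ℂ} {w x : A.domain}
    (h : A w = l • (w : Z)) : ⟪(w : Z), A x⟫_ℂ = l * ⟪(w : Z), (x : Z)⟫_ℂ := by
  rcases eq_or_ne (w : Z) 0 with h0 | h0
  · simp [h0]
  have hre := hA.re_eigenvalue h0 h
  have h1 := hA w x
  rw [h, inner_smul_left] at h1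
  have h2 : (starRingEnd ℂ) l = -l := by
    apply Complex.ext <;> simp [hre]
  rw [h2] at h1
  linear_combination h1

theorem IsSkewSymmetric.inner_resolventOp (hA : IsSkewSymmetric A) {l s : ℂ} (hs : s ∈ resolventSet A)
    {w : A.domain} (h : A w = l • (w : Z)) (z : Z) :
    (s - l) * ⟪(w : Z), resolventOp A s z⟫_ℂ = ⟪(w : Z), z⟫_ℂ := by
  obtain ⟨x, hx, hxz⟩ := exists_resolventOp_eq hs z
  have h1 := hA.inner_eigenvector (x := x) h
  rw [hxz, inner_sub_right, inner_smul_right] at h1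
  rw [← hx]
  linear_combination h1

/-- With x = R(s)z, the relation Re⟨x, Ax⟩ = 0 reads s‖x‖² = Re⟨x, z⟩. -/
theorem IsSkewSymmetric.norm_resolventOp_le (hA : IsSkewSymmetric A) {s : ℝ}
    (hsr : (s : ℂ) ∈ resolventSet A) (z : Z) : s * ‖resolventOp A s z‖ ≤ ‖z‖ := by
  obtain ⟨x, hx, hxz⟩ := exists_resolventOp_eq hsr z
  have h1 := hA.re_inner_self x
  rw [hxz, inner_sub_right, inner_smul_right, inner_self_eq_norm_sq_to_K, Complex.sub_re] at h1
  have h2 : ((‖(x : Z)‖ : ℂ) ^ 2) = ((‖(x : Z)‖ ^ 2 : ℝ) : ℂ) := by push_cast; rfl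
  simp only [Complex.coe_algebraMap, h2, ← Complex.ofReal_mul, Complex.ofReal_re] at h1
  have h3 : (⟪(x : Z), z⟫_ℂ).re ≤ ‖(x : Z)‖ * ‖z‖ :=
    (Complex.re_le_norm _).trans (norm_inner_le_norm _ _)
  rw [← hx]
  rcases eq_or_ne ‖(x : Z)‖ 0 with h0 | h0
  · rw [h0, mul_zero]; exact norm_nonneg _
  have hpos : 0 < ‖(x : Z)‖ := lt_of_le_of_ne (norm_nonneg _) h0.symm
  refine le_of_mul_le_mul_left ?_ hpos
  nlinarith

end Skew

/-! ### Invariant zeros and orthogonality -/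

section Zeros
variable [CompleteSpace Z] {A : Z →ₗ.[ℂ] Z} {b : Z}

theorem collocated_zeros_subset (hmin : (collocated A b).IsMinimal) :
    (collocated A b).invariantZeros ⊆ resolventSet A := by
  intro μ hμ
  by_contra h
  exact (Set.mem_empty_iff_false μ).1 (hmin ▸ ⟨hμ, h⟩)

theorem inner_resolventOp_eq_zero (hmin : (collocated A b).IsMinimal) {μ : ℂ}
    (hμ : μ ∈ (collocated A b).invariantZeros) : ⟪b, resolventOp A μ b⟫_ℂ = 0 := by
  have hr := collocated_zeros_subset hmin hμ
  obtain ⟨x, u, hx, h1, h2⟩ := hμ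
  change shift A μ x - u • b = 0 at h1
  have h3 : ⟪b, (x : Z)⟫_ℂ = 0 := by
    have h4 := congrArg (fun c => ⟪(1 : ℂ), c⟫_ℂ) h2
    simp only [collocated, zero_mul, add_zero, ContinuousLinearMap.adjoint_inner_right,
      inner_zero_right] at h4
    simpa using h4
  have h5 := resolventOp_eq_of_shift_eq hr (sub_eq_zero.1 h1)
  -- Here x = u R(μ)b, so a vanishing input would give x = 0.
  have hu : u ≠ 0 := by
    rintro rfl
    rw [zero_smul, map_zero] at h5
    exact hx h5.symm
  rw [← h5, map_smul, inner_smul_right] at h3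
  exact (mul_eq_zero.1 h3).resolve_left hu

theorem re_invariantZero (hA : IsSkewSymmetric A) (hb : b ≠ 0)
    (hmin : (collocated A b).IsMinimal) {μ : ℂ}
    (hμ : μ ∈ (collocated A b).invariantZeros) : μ.re = 0 := by
  have hr := collocated_zeros_subset hmin hμ
  have h0 := inner_resolventOp_eq_zero hmin hμ
  obtain ⟨x, hx, hxz⟩ := exists_resolventOp_eq hr b
  have hx0 : (x : Z) ≠ 0 := fun h => hb ((resolventOp_eq_zero_iff hr).1 (hx ▸ h))
  have h1 := hA.re_inner_self x
  have h2 : ((‖(x : Z)‖ : ℂ) ^ 2) = ((‖(x : Z)‖ ^ 2 : ℝ) : ℂ) := by push_cast; rfl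
  rw [hxz, inner_sub_right, inner_smul_right, inner_self_eq_norm_sq_to_K, hx,
    inner_eq_zero_symm.1 h0, ← hx, sub_zero] at h1
  simp only [Complex.coe_algebraMap, h2, Complex.re_mul_ofReal] at h1
  simpa [hx0] using h1

/-- Put Ax = μx - b and Ay = νy - b into ⟨Ax, y⟩ = -⟨x, Ay⟩: the terms with b vanish at zeros, and
the conjugate of μ is -μ. -/
theorem inner_resolventOp_resolventOp_eq_zero (hA : IsSkewSymmetric A) (hb : b ≠ 0)
    (hmin : (collocated A b).IsMinimal) {μ ν : ℂ}
    (hμ : μ ∈ (collocated A b).invariantZeros) (hν : ν ∈ (collocated A b).invariantZeros)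
    (hne : μ ≠ ν) : ⟪resolventOp A μ b, resolventOp A ν b⟫_ℂ = 0 := by
  obtain ⟨x, hx, hxz⟩ := exists_resolventOp_eq (collocated_zeros_subset hmin hμ) b
  obtain ⟨y, hy, hyz⟩ := exists_resolventOp_eq (collocated_zeros_subset hmin hν) b
  have h1 := hA x y
  have hc : (starRingEnd ℂ) μ = -μ := by
    apply Complex.ext <;> simp [re_invariantZero hA hb hmin hμ]
  rw [hxz, hyz, inner_sub_left, inner_sub_right, inner_smul_left, inner_smul_right, hx, hy,
    inner_resolventOp_eq_zero hmin hν, inner_eq_zero_symm.1 (inner_resolventOp_eq_zero hmin hμ),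
    hc] at h1
  have h2 : (ν - μ) * ⟪resolventOp A μ b, resolventOp A ν b⟫_ℂ = 0 := by linear_combination h1
  exact (mul_eq_zero.1 h2).resolve_left (sub_ne_zero.2 hne.symm)

theorem orthonormal_zeros (hA : IsSkewSymmetric A) (hb : b ≠ 0)
    (hmin : (collocated A b).IsMinimal) :
    Orthonormal ℂ (fun μ : (collocated A b).invariantZeros =>
      ((‖resolventOp A (μ : ℂ) b‖⁻¹ : ℝ) : ℂ) • resolventOp A (μ : ℂ) b) := by
  constructor
  · intro μ
    have h : resolventOp A (μ : ℂ) b ≠ 0 := fun h =>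
      hb ((resolventOp_eq_zero_iff (collocated_zeros_subset hmin μ.2)).1 h)
    rw [norm_smul, Complex.norm_real, norm_inv, norm_norm, inv_mul_cancel₀ (norm_ne_zero_iff.2 h)]
  · intro μ ν hne
    change ⟪_, _⟫_ℂ = 0
    rw [inner_smul_left, inner_smul_right, inner_resolventOp_resolventOp_eq_zero hA hb hmin μ.2 ν.2
      (fun h => hne (Subtype.ext h)), mul_zero, mul_zero]

theorem not_accPt_zeros (hA : IsSkewSymmetric A) (hb : b ≠ 0)
    (hmin : (collocated A b).IsMinimal) {p : ℂ} (hp : p ∈ resolventSet A) :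
    ¬ AccPt p (𝓟 (collocated A b).invariantZeros) := by
  intro hacc
  set S := (collocated A b).invariantZeros
  have hne : (𝓝[≠] p ⊓ 𝓟 S).NeBot := hacc
  have hle : 𝓝[≠] p ⊓ 𝓟 S ≤ 𝓝[resolventSet A] p := by
    refine le_inf (inf_le_left.trans nhdsWithin_le_nhds) (inf_le_right.trans ?_)
    exact principal_mono.2 (collocated_zeros_subset hmin)
  have ht : Tendsto (fun s => resolventOp A s b) (𝓝[≠] p ⊓ 𝓟 S) (𝓝 (resolventOp A p b)) :=
    (continuousOn_resolventOp A b p hp).tendsto.mono_left hle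
  have hS : ∀ᶠ s in 𝓝[≠] p ⊓ 𝓟 S, s ∈ S := mem_inf_of_right (mem_principal_self S)
  have h1 : ∀ᶠ s in 𝓝[≠] p ⊓ 𝓟 S, ⟪resolventOp A s b, resolventOp A p b⟫_ℂ = 0 := by
    have hpne : ∀ᶠ s in 𝓝[≠] p ⊓ 𝓟 S, s ≠ p := mem_inf_of_left self_mem_nhdsWithin
    filter_upwards [hS, hpne] with s hs hsp
    -- Two successive limits in ⟨R(s)b, R(t)b⟩ = 0: here t → p with s fixed, afterwards s → p,
    -- leaving ‖R(p)b‖² = 0.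
    refine tendsto_nhds_unique (tendsto_const_nhds.inner ht) ?_
    refine tendsto_const_nhds.congr' ?_
    have hsne : ∀ᶠ t in 𝓝[≠] p ⊓ 𝓟 S, t ≠ s :=
      mem_inf_of_left (mem_nhdsWithin_of_mem_nhds (isOpen_ne.mem_nhds hsp.symm))
    filter_upwards [hS, hsne] with t hts hne'
    exact (inner_resolventOp_resolventOp_eq_zero hA hb hmin hs hts hne'.symm).symm
  have h2 : ⟪resolventOp A p b, resolventOp A p b⟫_ℂ = 0 :=
    tendsto_nhds_unique (ht.inner tendsto_const_nhds)
      (tendsto_const_nhds.congr' (h1.mono fun _ h => h.symm))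
  exact hb ((resolventOp_eq_zero_iff hp).1 (inner_self_eq_zero.1 h2))

end Zeros
end

/-! ### Completeness of the eigenvectors -/

section Completeness
variable {Z : Type*} [NormedAddCommGroup Z] [InnerProductSpace ℂ Z] {A : Z →ₗ.[ℂ] Z}

/-- The eigenspace of `A` at `l`, as a closed subspace: `A x = l x` iff
`(1 - l) (I - A)⁻¹ x = x`. -/
noncomputable def eigenspace (A : Z →ₗ.[ℂ] Z) (l : ℂ) : Submodule ℂ Z :=
  LinearMap.ker (((1 - l) • resolventOp A 1 - 1 : Z →L[ℂ] Z) : Z →ₗ[ℂ] Z)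

theorem mem_eigenspace_iff {l : ℂ} {w : Z} :
    w ∈ eigenspace A l ↔ (1 - l) • resolventOp A 1 w = w := by
  simp [eigenspace, sub_eq_zero]

theorem exists_of_mem_eigenspace (h1 : (1 : ℂ) ∈ resolventSet A) {l : ℂ} {w : Z}
    (hw : w ∈ eigenspace A l) : ∃ x : A.domain, (x : Z) = w ∧ A x = l • w := by
  rw [mem_eigenspace_iff] at hw
  obtain ⟨x, hx, hxz⟩ := exists_resolventOp_eq h1 w
  refine ⟨(1 - l) • x, ?_, ?_⟩
  · rw [Submodule.coe_smul, hx, hw]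
  · rw [LinearPMap.map_smul, hxz, one_smul, smul_sub, hx, hw, sub_smul, one_smul, sub_sub_cancel]

instance eigenspace_completeSpace [CompleteSpace Z] (l : ℂ) : CompleteSpace (eigenspace A l) :=
  (ContinuousLinearMap.isClosed_ker ((1 - l) • resolventOp A 1 - 1 : Z →L[ℂ] Z)).completeSpace_coe

theorem orthogonalFamily_eigenspace (hA : IsSkewSymmetric A) (h1 : (1 : ℂ) ∈ resolventSet A) :
    OrthogonalFamily ℂ (fun l => eigenspace A l) (fun l => (eigenspace A l).subtypeₗᵢ) := by
  intro l m hlm v w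
  obtain ⟨x, hx, hxl⟩ := exists_of_mem_eigenspace h1 v.2
  obtain ⟨y, hy, hym⟩ := exists_of_mem_eigenspace h1 w.2
  change ⟪(v : Z), (w : Z)⟫_ℂ = 0
  have h2 := hA.inner_eigenvector (w := x) (x := y) (l := l) (by rw [hxl, hx])
  rw [hym, inner_smul_right, hx, hy] at h2
  have h3 : (m - l) * ⟪(v : Z), (w : Z)⟫_ℂ = 0 := by linear_combination h2
  exact (mul_eq_zero.1 h3).resolve_left (sub_ne_zero.2 hlm.symm)

theorem mem_spec_of_mem_spectrum (h1 : (1 : ℂ) ∈ resolventSet A) {r : ℂ} (hr0 : r ≠ 0)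
    (hr : r ∈ spectrum ℂ (resolventOp A 1)) : 1 - r⁻¹ ∈ spec A := by
  intro hl
  apply spectrum.mem_iff.1 hr
  have e1 : ∀ z, resolventOp A 1 z - resolventOp A (1 - r⁻¹) z
      = -(r⁻¹ • resolventOp A 1 (resolventOp A (1 - r⁻¹) z)) := by
    intro z
    rw [resolventOp_sub h1 hl]
    module
  have hS : ∀ z, resolventOp A (1 - r⁻¹) z = resolventOp A 1 z
      + r⁻¹ • resolventOp A 1 (resolventOp A (1 - r⁻¹) z) := by
    intro z
    have := e1 z
    rw [sub_eq_iff_eq_add] at this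
    conv_rhs => rw [this]
    abel
  set T := resolventOp A 1 with hT
  set S := resolventOp A (1 - r⁻¹) with hSdef
  have hcomm : ∀ z, T (S z) = S (T z) := fun z => resolventOp_comm h1 hl z
  have key : ∀ z, r • (r⁻¹ • (z + r⁻¹ • S z)) - T (r⁻¹ • (z + r⁻¹ • S z)) = z := by
    intro z
    have h2 : T (r⁻¹ • (z + r⁻¹ • S z)) = r⁻¹ • S z := by
      rw [map_smul, map_add, map_smul, ← hS]
    rw [h2, smul_smul, mul_inv_cancel₀ hr0, one_smul, add_sub_cancel_right]
  -- With l = 1 - r⁻¹ one has r - T = r(lI - A)T, whose inverse is r⁻¹(I - A)S; and (I - A)S = 1 +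
  -- r⁻¹S.
  let V : Z →L[ℂ] Z := r⁻¹ • (1 + r⁻¹ • S)
  have hV : ∀ z, V z = r⁻¹ • (z + r⁻¹ • S z) := fun z => rfl
  refine isUnit_iff_exists.2 ⟨V, ?_, ?_⟩
  · ext z
    simp only [mul_apply_eq_comp, sub_apply,
      Algebra.algebraMap_eq_smul_one, smul_apply,
      one_apply_eq_self, hV]
    exact key z
  · ext z
    simp only [mul_apply_eq_comp, sub_apply,
      Algebra.algebraMap_eq_smul_one, smul_apply,
      one_apply_eq_self, hV]
    conv_rhs => rw [← key z]
    simp only [map_sub, map_smul, map_add, hcomm, smul_sub, smul_add]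
    module

theorem finite_spec_inter_closedBall (hspec : HasDiscreteSpectrum A) (R : ℝ) :
    (spec A ∩ Metric.closedBall 0 R).Finite := by
  by_contra h
  obtain ⟨x, -, hx⟩ := Set.Infinite.exists_accPt_of_subset_isCompact h
    (isCompact_closedBall (0 : ℂ) R) Set.inter_subset_right
  exact hspec.not_accPt x (hx.mono (principal_mono.2 Set.inter_subset_left))

theorem finite_spectrum_inter (hspec : HasDiscreteSpectrum A) (h1 : (1 : ℂ) ∈ resolventSet A)
    {δ : ℝ} (hδ : 0 < δ) : {r ∈ spectrum ℂ (resolventOp A 1) | δ ≤ ‖r‖}.Finite := by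
  refine Set.Finite.of_finite_image (f := fun r : ℂ => 1 - r⁻¹)
    ((finite_spec_inter_closedBall hspec (1 + δ⁻¹)).subset ?_) ?_
  · rintro _ ⟨r, ⟨hr, hd⟩, rfl⟩
    have hpos : 0 < ‖r‖ := hδ.trans_le hd
    refine ⟨mem_spec_of_mem_spectrum h1 (norm_pos_iff.1 hpos) hr, ?_⟩
    rw [mem_closedBall_zero_iff]
    refine (norm_sub_le _ _).trans ?_
    rw [norm_one, norm_inv]
    gcongr
  · intro r _ s _ h
    simpa using h

/-- Nonzero points of the spectrum of (I - A)⁻¹ are isolated in it, so their indicators are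
admissible in the continuous functional calculus. -/
theorem continuousOn_single (hspec : HasDiscreteSpectrum A) (h1 : (1 : ℂ) ∈ resolventSet A)
    {r : ℂ} (hr : r ≠ 0) :
    ContinuousOn (fun z : ℂ => if z = r then (1 : ℂ) else 0) (spectrum ℂ (resolventOp A 1)) := by
  intro p _
  rcases eq_or_ne p r with rfl | hpr
  · have hpos : 0 < ‖p‖ := norm_pos_iff.2 hr
    have hfin : ({r ∈ spectrum ℂ (resolventOp A 1) | ‖p‖ / 2 ≤ ‖r‖} \ {p}).Finite :=
      (finite_spectrum_inter hspec h1 (half_pos hpos)).sdiff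
    have hn1 : ∀ᶠ z in 𝓝 p, z ∉ {r ∈ spectrum ℂ (resolventOp A 1) | ‖p‖ / 2 ≤ ‖r‖} \ {p} :=
      hfin.isClosed.isOpen_compl.mem_nhds (by simp)
    have hn2 : ∀ᶠ z in 𝓝 p, ‖p‖ / 2 < ‖z‖ :=
      continuous_norm.continuousAt.eventually_const_lt (half_lt_self hpos)
    refine (continuousWithinAt_const (b := (1 : ℂ))).congr_of_eventuallyEq ?_ (by simp)
    filter_upwards [hn1.filter_mono nhdsWithin_le_nhds, hn2.filter_mono nhdsWithin_le_nhds,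
      self_mem_nhdsWithin] with z hz1 hz2 hz3
    have : z = p := by
      by_contra hne
      exact hz1 ⟨⟨hz3, hz2.le⟩, hne⟩
    simp [this]
  · refine (continuousWithinAt_const (b := (0 : ℂ))).congr_of_eventuallyEq ?_ (by simp [hpr])
    filter_upwards [mem_nhdsWithin_of_mem_nhds (isOpen_ne.mem_nhds hpr)] with z hz
    exact if_neg hz

theorem inner_hasSum_eigenvectors (hA : IsSkewSymmetric A) (hspec : HasDiscreteSpectrum A)
    {w : ℂ → Z} (hw : ∀ l, w l ∈ eigenspace A l) {b : Z} (hb : HasSum w b) {l : ℂ} {v : Z}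
    (hv : v ∈ eigenspace A l) : ⟪v, b⟫_ℂ = ⟪v, w l⟫_ℂ := by
  refine (hb.mapL (innerSL ℂ v)).unique (hasSum_single l fun m hm => ?_)
  exact orthogonalFamily_eigenspace hA (hA.mem_resolventSet hspec (by simp)) hm.symm
    ⟨v, hv⟩ ⟨w m, hw m⟩

variable [CompleteSpace Z]

theorem star_resolventOp_one (hA : IsSkewSymmetric A) (h1 : (1 : ℂ) ∈ resolventSet A)
    (h2 : (-1 : ℂ) ∈ resolventSet A) : star (resolventOp A 1) = -resolventOp A (-1) := by
  rw [ContinuousLinearMap.star_eq_adjoint]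
  symm
  rw [ContinuousLinearMap.eq_adjoint_iff]
  intro z w
  obtain ⟨x, hx, hxz⟩ := exists_resolventOp_eq h2 z
  obtain ⟨y, hy, hyz⟩ := exists_resolventOp_eq h1 w
  have h := hA x y
  rw [hxz, hyz, hx, hy, inner_sub_left, inner_sub_right, inner_smul_left, inner_smul_right] at h
  simp only [map_neg, map_one, one_mul] at h
  rw [neg_apply, inner_neg_left]
  linear_combination h

theorem isStarNormal_resolventOp_one (hA : IsSkewSymmetric A) (h1 : (1 : ℂ) ∈ resolventSet A)
    (h2 : (-1 : ℂ) ∈ resolventSet A) : IsStarNormal (resolventOp A 1) := by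
  constructor
  rw [star_resolventOp_one hA h1 h2]
  refine Commute.neg_left ?_
  ext z
  exact resolventOp_comm h2 h1 z

/-- The spectral projections of T = (I - A)⁻¹ at nonzero r map into eigenspaces of A, so they kill
z. Removing the finitely many spectral values of modulus at least δ leaves an operator of norm at
most δ that agrees with T at z. Hence Tz = 0, and T is injective. -/
theorem eq_zero_of_orthogonal_eigenspaces (hA : IsSkewSymmetric A) (hspec : HasDiscreteSpectrum A)
    {z : Z} (hz : ∀ l, ∀ w ∈ eigenspace A l, ⟪z, w⟫_ℂ = 0) : z = 0 := by
  have h1 : (1 : ℂ) ∈ resolventSet A := hA.mem_resolventSet hspec (by simp)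
  have h2 : (-1 : ℂ) ∈ resolventSet A := hA.mem_resolventSet hspec (by simp)
  have hn := isStarNormal_resolventOp_one hA h1 h2
  rw [← resolventOp_eq_zero_iff h1]
  set T := resolventOp A 1 with hT
  let χ : ℂ → ℂ → ℂ := fun r z => if z = r then 1 else 0
  have hχ : ∀ r ≠ 0, ContinuousOn (χ r) (spectrum ℂ T) :=
    fun r hr => continuousOn_single hspec h1 hr
  have hTχ : ∀ r ≠ 0, T * cfc (χ r) T = r • cfc (χ r) T := by
    intro r hr
    have hc := hχ r hr
    conv_lhs => enter [1]; rw [← cfc_id' ℂ T]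
    rw [← cfc_mul _ _ T, ← cfc_smul _ _ T]
    congr 1
    ext z
    by_cases h : z = r <;> simp [χ, h]
  have hPz : ∀ r ≠ 0, cfc (χ r) T z = 0 := by
    intro r hr
    have hstar : star (cfc (χ r) T) = cfc (χ r) T := by
      rw [← cfc_star]
      congr 1
      ext z
      by_cases h : z = r <;> simp [χ, h]
    rw [← inner_self_eq_zero (𝕜 := ℂ)]
    conv_lhs => rw [← hstar, ContinuousLinearMap.star_eq_adjoint]
    rw [ContinuousLinearMap.adjoint_inner_left]
    -- T acts as r exactly where A acts as 1 - r⁻¹.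
    refine hz (1 - r⁻¹) _ ?_
    rw [mem_eigenspace_iff, ← ContinuousLinearMap.star_eq_adjoint, hstar]
    have h3 := congrArg (fun S : Z →L[ℂ] Z => S (cfc (χ r) T z)) (hTχ r hr)
    simp only [mul_apply_eq_comp, smul_apply] at h3
    rw [← hT, h3, smul_smul, sub_sub_cancel, inv_mul_cancel₀ hr, one_smul]
  have hle : ∀ δ > 0, ‖T z‖ ≤ δ * ‖z‖ := by
    intro δ hδ
    have hfin := finite_spectrum_inter hspec h1 hδ
    set F := hfin.toFinset with hF
    have hF0 : ∀ r ∈ F, r ≠ 0 := by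
      intro r hr
      rw [hF, Set.Finite.mem_toFinset] at hr
      exact norm_pos_iff.1 (hδ.trans_le hr.2)
    have hcont : ∀ r ∈ F, ContinuousOn (fun z => r • χ r z) (spectrum ℂ T) :=
      fun r hr => (hχ r (hF0 r hr)).const_smul r
    have hcont' : ContinuousOn (∑ r ∈ F, fun z => r • χ r z) (spectrum ℂ T) := by
      have := continuousOn_finsetSum F hcont
      refine this.congr fun z _ => ?_
      simp
    have hsum : cfc (fun z => z - (∑ r ∈ F, fun z => r • χ r z) z) T
        = T - ∑ r ∈ F, r • cfc (χ r) T := by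
      rw [cfc_sub (fun z => z) _ T continuousOn_id hcont', cfc_id' ℂ T, cfc_sum _ T F hcont]
      congr 1
      refine Finset.sum_congr rfl fun r hr => ?_
      exact cfc_smul r (χ r) T (hχ r (hF0 r hr))
    have hnorm : ‖T - ∑ r ∈ F, r • cfc (χ r) T‖ ≤ δ := by
      rw [← hsum]
      refine norm_cfc_le hδ.le fun x hx => ?_
      by_cases hxF : x ∈ F
      · simp [χ, hxF, hδ.le]
      · have hlt : ‖x‖ < δ := by
          by_contra hge
          exact hxF (by rw [hF, Set.Finite.mem_toFinset]; exact ⟨hx, not_lt.1 hge⟩)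
        simpa [χ, hxF] using hlt.le
    have happ : (T - ∑ r ∈ F, r • cfc (χ r) T) z = T z := by
      rw [sub_apply, sum_apply,
        Finset.sum_eq_zero, sub_zero]
      intro r hr
      rw [smul_apply, hPz r (hF0 r hr), smul_zero]
    rw [← happ]
    exact (ContinuousLinearMap.le_opNorm _ _).trans (by gcongr)
  rw [← norm_le_zero_iff]
  have ht : Tendsto (fun δ : ℝ => δ * ‖z‖) (𝓝[>] 0) (𝓝 0) := by
    have : ContinuousAt (fun δ : ℝ => δ * ‖z‖) 0 := by fun_prop
    simpa [ContinuousAt] using this.tendsto.mono_left (nhdsWithin_le_nhds (s := Set.Ioi 0))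
  exact ge_of_tendsto ht (by filter_upwards [self_mem_nhdsWithin] with δ hδ using hle δ hδ)

/-- The index runs over all of ℂ; values that are not eigenvalues contribute the zero space. -/
theorem isHilbertSum_eigenspace (hA : IsSkewSymmetric A) (hspec : HasDiscreteSpectrum A) :
    IsHilbertSum ℂ (fun l => eigenspace A l) (fun l => (eigenspace A l).subtypeₗᵢ) := by
  refine IsHilbertSum.mkInternal _
    (orthogonalFamily_eigenspace hA (hA.mem_resolventSet hspec (by simp))) (top_le_iff.2 ?_)
  rw [Submodule.topologicalClosure_eq_top_iff, Submodule.eq_bot_iff]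
  intro z hz
  refine eq_zero_of_orthogonal_eigenspaces hA hspec fun l w hw => ?_
  exact inner_eq_zero_symm.1 (hz w (Submodule.mem_iSup_of_mem l hw))

/-- Expansion of a vector in eigenvectors. -/
theorem exists_hasSum_eigenvectors (hA : IsSkewSymmetric A) (hspec : HasDiscreteSpectrum A)
    (b : Z) : ∃ w : ℂ → Z, (∀ l, w l ∈ eigenspace A l) ∧ HasSum w b ∧
      Summable (fun l => ‖w l‖ ^ 2) := by
  have hV := isHilbertSum_eigenspace hA hspec
  have hs := hV.hasSum_linearIsometryEquiv_symm (hV.linearIsometryEquiv b)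
  rw [LinearIsometryEquiv.symm_apply_apply] at hs
  refine ⟨fun l => (hV.linearIsometryEquiv b l : Z), fun l => Subtype.coe_prop _, hs, ?_⟩
  have := (lp.memℓp (hV.linearIsometryEquiv b)).summable (by norm_num)
  simpa using this

end Completeness

/-! ### The Balakrishnan integral on eigenvectors -/

section Balakrishnan
open MeasureTheory
variable {Z : Type*} [NormedAddCommGroup Z] [InnerProductSpace ℂ Z] {A : Z →ₗ.[ℂ] Z}

/-- Near 0, R(s)(-Ax) = x - sR(s)x is bounded by 2‖x‖; at infinity its norm is at most ‖Ax‖/s. The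
integrand is thus dominated by multiples of s^(-1/2) and s^(-3/2). -/
theorem integrableOn_balakrishnan (hA : IsSkewSymmetric A) (hspec : HasDiscreteSpectrum A)
    (x : A.domain) :
    IntegrableOn (fun s : ℝ => ((s ^ ((1 / 2 : ℝ) - 1) : ℝ) : ℂ) • resolventOp A (s : ℂ) (-(A x)))
      (Set.Ioi 0) := by
  have hres : ∀ s : ℝ, s ∈ Set.Ioi (0 : ℝ) → (s : ℂ) ∈ resolventSet A := fun s hs =>
    hA.mem_resolventSet hspec (by simpa using ne_of_gt (Set.mem_Ioi.1 hs))
  have hcont : ContinuousOn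
      (fun s : ℝ => ((s ^ ((1 / 2 : ℝ) - 1) : ℝ) : ℂ) • resolventOp A (s : ℂ) (-(A x)))
      (Set.Ioi 0) := by
    refine ContinuousOn.smul ?_ ?_
    · refine Complex.continuous_ofReal.comp_continuousOn ?_
      exact continuousOn_id.rpow_const fun s hs => Or.inl (ne_of_gt hs)
    · exact (continuousOn_resolventOp A (-(A x))).comp Complex.continuous_ofReal.continuousOn hres
  have hbd : ∀ s ∈ Set.Ioi (0 : ℝ),
      s * ‖resolventOp A (s : ℂ) (-(A x))‖ ≤ ‖A x‖ ∧
        ‖resolventOp A (s : ℂ) (-(A x))‖ ≤ 2 * ‖(x : Z)‖ := by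
    intro s hs
    refine ⟨by simpa using hA.norm_resolventOp_le (hres s hs) (-(A x)), ?_⟩
    have h1 : resolventOp A (s : ℂ) (-(A x)) = x - (s : ℂ) • resolventOp A (s : ℂ) (x : Z) := by
      have h := (isResolventAt_resolventOp (hres s hs)).1 x
      rw [shift_apply, map_sub, map_smul, sub_eq_iff_eq_add] at h
      rw [map_neg, h]
      abel
    have h2 := hA.norm_resolventOp_le (hres s hs) (x : Z)
    rw [h1]
    refine (norm_sub_le _ _).trans ?_
    rw [norm_smul, Complex.norm_real, Real.norm_of_nonneg (le_of_lt hs)]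
    linarith
  have hnorm : ∀ s ∈ Set.Ioi (0 : ℝ),
      ‖((s ^ ((1 / 2 : ℝ) - 1) : ℝ) : ℂ) • resolventOp A (s : ℂ) (-(A x))‖
        = s ^ ((1 / 2 : ℝ) - 1) * ‖resolventOp A (s : ℂ) (-(A x))‖ := by
    intro s hs
    rw [norm_smul, Complex.norm_real, Real.norm_of_nonneg (Real.rpow_nonneg (le_of_lt hs) _)]
  rw [← Set.Ioc_union_Ioi_eq_Ioi zero_le_one]
  refine IntegrableOn.union ?_ ?_
  · have hi : IntegrableOn (fun s : ℝ => s ^ ((1 / 2 : ℝ) - 1) * (2 * ‖(x : Z)‖))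
        (Set.Ioc 0 1) := by
      refine Integrable.mul_const ?_ _
      have := intervalIntegral.intervalIntegrable_rpow' (a := 0) (b := 1)
        (r := (1 / 2 : ℝ) - 1) (by norm_num)
      exact (intervalIntegrable_iff_integrableOn_Ioc_of_le zero_le_one).1 this
    refine Integrable.mono' hi ((hcont.mono Set.Ioc_subset_Ioi_self).aestronglyMeasurable
      measurableSet_Ioc) ?_
    filter_upwards [ae_restrict_mem measurableSet_Ioc] with s hs
    rw [hnorm s hs.1]
    exact mul_le_mul_of_nonneg_left (hbd s hs.1).2 (Real.rpow_nonneg hs.1.le _)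
  · have hi : IntegrableOn (fun s : ℝ => s ^ (-(3 / 2) : ℝ) * ‖A x‖) (Set.Ioi 1) :=
      Integrable.mul_const (integrableOn_Ioi_rpow_of_lt (by norm_num) zero_lt_one) _
    refine Integrable.mono' hi ((hcont.mono (Set.Ioi_subset_Ioi zero_le_one)).aestronglyMeasurable
      measurableSet_Ioi) ?_
    filter_upwards [ae_restrict_mem measurableSet_Ioi] with s hs
    have hs0 : 0 < s := zero_lt_one.trans hs
    rw [hnorm s hs0]
    have h3 : s ^ ((1 / 2 : ℝ) - 1) = s ^ (-(3 / 2) : ℝ) * s := by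
      rw [← Real.rpow_add_one hs0.ne']
      norm_num
    rw [h3, mul_assoc]
    exact mul_le_mul_of_nonneg_left (hbd s hs0).1 (Real.rpow_nonneg hs0.le _)

/-- The symbol `(1 / π) ∫₀^∞ s ^ (-1/2) (-l) / (s - l) ds` of the Balakrishnan integral. -/
noncomputable def balakrishnanSymbol (l : ℂ) : ℂ :=
  ((Real.pi)⁻¹ : ℂ) * ∫ s in Set.Ioi (0 : ℝ), ((s ^ ((1 / 2 : ℝ) - 1) : ℝ) : ℂ) * (-l / (s - l))

theorem symbol_integrand_eq (hA : IsSkewSymmetric A) (hspec : HasDiscreteSpectrum A) {l : ℂ}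
    {w x : A.domain} (hw : A w = l • (w : Z)) {s : ℝ} (hs : 0 < s) :
    ⟪(w : Z), ((s ^ ((1 / 2 : ℝ) - 1) : ℝ) : ℂ) • resolventOp A (s : ℂ) (-(A x))⟫_ℂ
      = ((s ^ ((1 / 2 : ℝ) - 1) : ℝ) : ℂ) * (-l / (s - l)) * ⟪(w : Z), (x : Z)⟫_ℂ := by
  rcases eq_or_ne (w : Z) 0 with h0 | h0
  · simp [h0]
  have hl := hA.re_eigenvalue h0 hw
  have hne : (s : ℂ) - l ≠ 0 := by
    intro h
    have := congrArg Complex.re h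
    simp [hl] at this
    exact hs.ne' this
  have h1 := hA.inner_resolventOp (s := s)
    (hA.mem_resolventSet hspec (by simpa using hs.ne')) hw (-(A x))
  rw [inner_neg_right, hA.inner_eigenvector hw] at h1
  rw [inner_smul_right, mul_assoc]
  congr 1
  rw [div_mul_eq_mul_div, eq_div_iff hne]
  linear_combination h1

theorem inner_balakrishnan [CompleteSpace Z] (hA : IsSkewSymmetric A)
    (hspec : HasDiscreteSpectrum A) {l : ℂ} {w : A.domain} (hw : A w = l • (w : Z))
    (x : A.domain) :
    ⟪(w : Z), balakrishnan A (1 / 2) x⟫_ℂ = balakrishnanSymbol l * ⟪(w : Z), (x : Z)⟫_ℂ := by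
  rw [balakrishnan, inner_smul_right, ← integral_inner (integrableOn_balakrishnan hA hspec x),
    setIntegral_congr_fun measurableSet_Ioi
      (fun s hs => symbol_integrand_eq hA hspec hw (x := x) hs),
    integral_mul_const, balakrishnanSymbol, mul_assoc]
  have : Real.sin (Real.pi * (1 / 2)) = 1 := by
    rw [mul_one_div, Real.sin_pi_div_two]
  rw [this]
  simp

/-- For imaginary l the real part of -l/(s - l) is |l|²/(s² + |l|²), which is at least 1/2 on (0,
|l|]; integrating s^(-1/2)/2 there gives √|l|. The exact value of the symbol is not needed. -/
theorem sqrt_le_norm_balakrishnanSymbol (hA : IsSkewSymmetric A)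
    (hspec : HasDiscreteSpectrum A) {l : ℂ} {w : A.domain} (hw0 : (w : Z) ≠ 0)
    (hw : A w = l • (w : Z)) :
    Real.pi⁻¹ * Real.sqrt ‖l‖ ≤ ‖balakrishnanSymbol l‖ := by
  have hl := hA.re_eigenvalue hw0 hw
  set f : ℝ → ℂ := fun s => ((s ^ ((1 / 2 : ℝ) - 1) : ℝ) : ℂ) * (-l / (s - l)) with hf
  have hint : IntegrableOn f (Set.Ioi 0) := by
    -- Integrability is inherited from the vector integrand at x = w, paired with w.
    have h1 : IntegrableOn (fun s => f s * ⟪(w : Z), (w : Z)⟫_ℂ) (Set.Ioi 0) := by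
      refine ((integrableOn_balakrishnan hA hspec w).const_inner (𝕜 := ℂ) (w : Z)).congr ?_
      filter_upwards [ae_restrict_mem measurableSet_Ioi] with s hs
      exact symbol_integrand_eq hA hspec hw hs
    have h2 := Integrable.mul_const h1 (⟪(w : Z), (w : Z)⟫_ℂ)⁻¹
    refine h2.congr (Eventually.of_forall fun s => ?_)
    exact mul_inv_cancel_right₀ (inner_self_ne_zero.2 hw0) _
  have hre : ∀ s : ℝ, 0 < s →
      (f s).re = s ^ ((1 / 2 : ℝ) - 1) * (‖l‖ ^ 2 / (s ^ 2 + ‖l‖ ^ 2)) := by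
    intro s hs
    have hn : ‖l‖ ^ 2 = l.im * l.im := by
      rw [← Complex.normSq_eq_norm_sq, Complex.normSq_apply, hl]
      ring
    have hns : Complex.normSq (s - l) = s ^ 2 + ‖l‖ ^ 2 := by
      rw [Complex.normSq_apply, hn]
      simp [hl]
      ring
    simp only [hf, Complex.re_ofReal_mul]
    congr 1
    rw [Complex.div_re, hns]
    simp only [Complex.neg_re, Complex.neg_im, Complex.sub_re, Complex.sub_im, Complex.ofReal_re,
      Complex.ofReal_im, hl, hn]
    ring
  have hlow : Real.sqrt ‖l‖ ≤ ∫ s in Set.Ioi (0 : ℝ), (f s).re := by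
    have h3 : ∫ s in Set.Ioc (0 : ℝ) ‖l‖, s ^ ((1 / 2 : ℝ) - 1) * (1 / 2) = Real.sqrt ‖l‖ := by
      rw [← intervalIntegral.integral_of_le (norm_nonneg l), intervalIntegral.integral_mul_const,
        integral_rpow (Or.inl (by norm_num)), Real.sqrt_eq_rpow]
      norm_num
    rw [← h3]
    have hi : IntegrableOn (fun s => (f s).re) (Set.Ioi 0) := hint.re
    have h4 : ∫ s in Set.Ioc (0 : ℝ) ‖l‖, (f s).re ≤ ∫ s in Set.Ioi (0 : ℝ), (f s).re := by
      refine setIntegral_mono_set hi ?_ Set.Ioc_subset_Ioi_self.eventuallyLE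
      filter_upwards [ae_restrict_mem measurableSet_Ioi] with s hs
      rw [hre s hs]
      have : 0 ≤ s ^ ((1 / 2 : ℝ) - 1) := Real.rpow_nonneg (le_of_lt hs) _
      change (0 : ℝ) ≤ _
      positivity
    refine le_trans (setIntegral_mono_on ?_ (hi.mono_set Set.Ioc_subset_Ioi_self)
      measurableSet_Ioc fun s hs => ?_) h4
    · refine Integrable.mul_const ?_ _
      have := intervalIntegral.intervalIntegrable_rpow' (a := 0) (b := ‖l‖)
        (r := (1 / 2 : ℝ) - 1) (by norm_num)
      exact (intervalIntegrable_iff_integrableOn_Ioc_of_le (norm_nonneg l)).1 this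
    · rw [hre s hs.1]
      refine mul_le_mul_of_nonneg_left ?_ (Real.rpow_nonneg hs.1.le _)
      have hpos : 0 < s ^ 2 := by have := hs.1; positivity
      have hle : s ^ 2 ≤ ‖l‖ ^ 2 := by
        have := hs.1.le
        have := hs.2
        gcongr
      rw [div_le_div_iff₀ two_pos (by positivity)]
      linarith
  have hnorm : ‖∫ s in Set.Ioi (0 : ℝ), f s‖ ≥ Real.sqrt ‖l‖ := by
    refine le_trans hlow ?_
    have : ∫ s in Set.Ioi (0 : ℝ), (f s).re = (∫ s in Set.Ioi (0 : ℝ), f s).re :=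
      integral_re hint
    rw [this]
    exact Complex.re_le_norm _
  rw [balakrishnanSymbol, norm_mul, norm_inv, Complex.norm_real,
    Real.norm_of_nonneg Real.pi_pos.le]
  exact mul_le_mul_of_nonneg_left hnorm (inv_nonneg.2 Real.pi_pos.le)

theorem inner_eq_of_mem_fracPowGraph [CompleteSpace Z] (hA : IsSkewSymmetric A)
    (hspec : HasDiscreteSpectrum A) {l : ℂ} {w : A.domain} (hw : A w = l • (w : Z)) {z y : Z}
    (hzy : (z, y) ∈ fracPowGraph A (1 / 2)) :
    ⟪(w : Z), y⟫_ℂ = balakrishnanSymbol l * ⟪(w : Z), z⟫_ℂ := by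
  have hclosed : IsClosed
      {p : Z × Z | ⟪(w : Z), p.2⟫_ℂ = balakrishnanSymbol l * ⟪(w : Z), p.1⟫_ℂ} :=
    isClosed_eq (by fun_prop) (by fun_prop)
  refine closure_minimal ?_ hclosed hzy
  rintro _ ⟨x, rfl⟩
  exact inner_balakrishnan hA hspec hw x

end Balakrishnan

/-! ### Location of the zeros -/

section Asymptotics
variable {Z : Type*} [NormedAddCommGroup Z] [InnerProductSpace ℂ Z] [CompleteSpace Z]
  {A : Z →ₗ.[ℂ] Z} {b : Z}

/-- If y is a value of the fractional power at b, with components v_l, the symbol bound gives √|l|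
‖w_l‖ ≤ π‖v_l‖, and ‖v_l‖² is summable. -/
theorem summable_norm_mul_norm_sq (hA : IsSkewSymmetric A) (hspec : HasDiscreteSpectrum A)
    (hbdom : b ∈ fracPowDomain A (1 / 2)) {w : ℂ → Z} (hw : ∀ l, w l ∈ eigenspace A l)
    (hwb : HasSum w b) : Summable (fun l => ‖l‖ * ‖w l‖ ^ 2) := by
  obtain ⟨y, hy⟩ := hbdom
  obtain ⟨v, hv, hvy, hsum⟩ := exists_hasSum_eigenvectors hA hspec y
  refine Summable.of_nonneg_of_le (fun l => by positivity) (fun l => ?_)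
    (hsum.mul_left (Real.pi ^ 2))
  rcases eq_or_ne (w l) 0 with h0 | h0
  · rw [h0, norm_zero, zero_pow two_ne_zero, mul_zero]
    exact mul_nonneg (sq_nonneg _) (sq_nonneg _)
  obtain ⟨x, hx, hxl⟩ :=
    exists_of_mem_eigenspace (hA.mem_resolventSet hspec (by simp)) (hw l)
  rw [← hx] at hxl
  have hc := sqrt_le_norm_balakrishnanSymbol hA hspec (by rwa [hx]) hxl
  have h1 := inner_eq_of_mem_fracPowGraph hA hspec hxl hy
  rw [hx, inner_hasSum_eigenvectors hA hspec hw hwb (hw l),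
    inner_hasSum_eigenvectors hA hspec hv hvy (hw l)] at h1
  have hpos : 0 < ‖w l‖ := norm_pos_iff.2 h0
  have h2 : ‖balakrishnanSymbol l‖ * (‖w l‖ * ‖w l‖) ≤ ‖w l‖ * ‖v l‖ := by
    have := norm_inner_le_norm (𝕜 := ℂ) (w l) (v l)
    rwa [h1, norm_mul, inner_self_eq_norm_sq_to_K, norm_pow, RCLike.norm_ofReal, abs_norm,
      pow_two] at this
  have h3 : Real.pi⁻¹ * Real.sqrt ‖l‖ * ‖w l‖ ≤ ‖v l‖ := by
    refine le_trans (mul_le_mul_of_nonneg_right hc hpos.le) ?_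
    refine le_of_mul_le_mul_left ?_ hpos
    linarith
  have h4 : Real.sqrt ‖l‖ * ‖w l‖ ≤ Real.pi * ‖v l‖ := by
    rw [mul_assoc, inv_mul_le_iff₀ Real.pi_pos] at h3
    exact h3
  calc ‖l‖ * ‖w l‖ ^ 2 = (Real.sqrt ‖l‖ * ‖w l‖) ^ 2 := by
        rw [mul_pow, Real.sq_sqrt (norm_nonneg l)]
    _ ≤ (Real.pi * ‖v l‖) ^ 2 := by gcongr
    _ = Real.pi ^ 2 * ‖v l‖ ^ 2 := mul_pow _ _ _

/-- Termwise, l/(μ - l) = μ/(μ - l) - 1, so the sum is μ⟨b, R(μ)b⟩ - ⟨b, b⟩. This form keeps a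
nonzero right-hand side as μ → ∞. -/
theorem hasSum_eigenvalue_mul_inner (hA : IsSkewSymmetric A) (hspec : HasDiscreteSpectrum A)
    (hmin : (collocated A b).IsMinimal) {w : ℂ → Z} (hw : ∀ l, w l ∈ eigenspace A l)
    (hwb : HasSum w b) {μ : ℂ} (hμ : μ ∈ (collocated A b).invariantZeros) :
    HasSum (fun l => l * ((‖w l‖ : ℂ) ^ 2 / (μ - l))) (-⟪b, b⟫_ℂ) := by
  have hr := collocated_zeros_subset hmin hμ
  have hconj : ∀ z : Z, HasSum (fun l => ⟪w l, z⟫_ℂ) ⟪b, z⟫_ℂ := by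
    intro z
    simpa using Complex.hasSum_conj'.2 (hwb.mapL (innerSL ℂ z))
  have h1 := ((hconj (resolventOp A μ b)).mul_left μ).sub (hconj b)
  rw [inner_resolventOp_eq_zero hmin hμ, mul_zero, zero_sub] at h1
  refine h1.congr_fun ?_
  intro l
  obtain ⟨x, hx, hxl⟩ :=
    exists_of_mem_eigenspace (hA.mem_resolventSet hspec (by simp)) (hw l)
  rw [← hx] at hxl
  have h2 := hA.inner_resolventOp hr hxl b
  have h3 : ⟪w l, b⟫_ℂ = (‖w l‖ : ℂ) ^ 2 := by
    rw [inner_hasSum_eigenvectors hA hspec hw hwb (hw l), inner_self_eq_norm_sq_to_K]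
    rfl
  rw [hx, h3] at h2
  rw [h3]
  -- The index l = μ occurs too; there w l = 0 and the quotient is 0/0 = 0.
  rcases eq_or_ne (w l) 0 with h0 | h0
  · simp [h0]
  have hne : μ - l ≠ 0 := by
    intro h
    rw [h, zero_mul] at h2
    exact pow_ne_zero 2 (Complex.ofReal_ne_zero.2 (norm_ne_zero_iff.2 h0)) h2.symm
  rw [← h2]
  field_simp
  ring

/-- The zeros at distance at least `ε` from the eigenvalues are bounded. -/
theorem isBounded_zeros_away (hA : IsSkewSymmetric A) (hspec : HasDiscreteSpectrum A)
    (hb : b ≠ 0) (hmin : (collocated A b).IsMinimal) (hbdom : b ∈ fracPowDomain A (1 / 2))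
    {ε : ℝ} (hε : 0 < ε) :
    Bornology.IsBounded {μ ∈ (collocated A b).invariantZeros |
      ∀ l, IsEigenvalue A l → ε ≤ ‖μ - l‖} := by
  set S := {μ ∈ (collocated A b).invariantZeros | ∀ l, IsEigenvalue A l → ε ≤ ‖μ - l‖}
  obtain ⟨w, hw, hwb, -⟩ := exists_hasSum_eigenvectors hA hspec b
  rw [Bornology.isBounded_def, ← inf_principal_eq_bot]
  by_contra hne
  have : (Bornology.cobounded ℂ ⊓ 𝓟 S).NeBot := ⟨hne⟩
  have hS : ∀ᶠ μ in Bornology.cobounded ℂ ⊓ 𝓟 S, μ ∈ S :=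
    mem_inf_of_right (mem_principal_self S)
  -- On S, |μ - l| ≥ ε whenever w l ≠ 0, which gives a majorant independent of μ.
  have hlim := tendsto_tsum_of_dominated_convergence
    (𝓕 := Bornology.cobounded ℂ ⊓ 𝓟 S) (f := fun μ l => l * ((‖w l‖ : ℂ) ^ 2 / (μ - l)))
    (g := fun _ => (0 : ℂ)) (bound := fun l => ‖l‖ * ‖w l‖ ^ 2 * ε⁻¹)
    ((summable_norm_mul_norm_sq hA hspec hbdom hw hwb).mul_right _) ?_ ?_
  · rw [tsum_zero] at hlim
    have hconst : (-⟪b, b⟫_ℂ) = 0 := by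
      refine tendsto_nhds_unique (tendsto_const_nhds.congr' ?_) hlim
      filter_upwards [hS] with μ hμ
      exact (hasSum_eigenvalue_mul_inner hA hspec hmin hw hwb hμ.1).tsum_eq.symm
    exact hb (inner_self_eq_zero.1 (neg_eq_zero.1 hconst))
  · intro l
    have h1 : Tendsto (fun μ : ℂ => (μ - l)⁻¹) (Bornology.cobounded ℂ) (𝓝 0) :=
      tendsto_inv₀_cobounded.comp (tendsto_sub_const_cobounded l)
    have h2 := ((h1.const_mul ((‖w l‖ : ℂ) ^ 2)).const_mul l).mono_left
      (inf_le_left (b := 𝓟 S))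
    simpa [div_eq_mul_inv] using h2
  · filter_upwards [hS] with μ hμ l
    rcases eq_or_ne (w l) 0 with h0 | h0
    · simp [h0]
    obtain ⟨x, hx, hxl⟩ :=
      exists_of_mem_eigenspace (hA.mem_resolventSet hspec (by simp)) (hw l)
    rw [← hx] at hxl
    have hd := hμ.2 l ⟨x, by rwa [hx], hxl⟩
    rw [norm_mul, norm_div, norm_pow, Complex.norm_real, norm_norm, mul_assoc, div_eq_mul_inv]
    gcongr

theorem finite_zeros_away (hA : IsSkewSymmetric A) (hspec : HasDiscreteSpectrum A)
    (hb : b ≠ 0) (hmin : (collocated A b).IsMinimal) (hbdom : b ∈ fracPowDomain A (1 / 2))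
    {ε : ℝ} (hε : 0 < ε) :
    {μ ∈ (collocated A b).invariantZeros | ∀ l, IsEigenvalue A l → ε ≤ ‖μ - l‖}.Finite := by
  by_contra hinf
  obtain ⟨p, hp, hacc⟩ := Set.Infinite.exists_accPt_of_subset_isCompact hinf
    (isBounded_zeros_away hA hspec hb hmin hbdom hε).isCompact_closure subset_closure
  -- A limit p in the spectrum would be an eigenvalue, and closedness would give ε ≤ ‖p - p‖.
  have hpr : p ∈ resolventSet A := by
    by_contra hps
    have hclosed : IsClosed {μ : ℂ | ε ≤ ‖μ - p‖} :=
      isClosed_le continuous_const (by fun_prop)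
    have := closure_minimal (fun μ hμ => hμ.2 p (hspec.eigenvalue p hps)) hclosed hp
    simp only [Set.mem_ofPred_eq, sub_self, norm_zero] at this
    exact absurd this (not_le.2 hε)
  exact not_accPt_zeros hA hb hmin hpr (hacc.mono (principal_mono.2 fun μ hμ => hμ.1))

theorem countable_zeros (hA : IsSkewSymmetric A) (hspec : HasDiscreteSpectrum A)
    (hb : b ≠ 0) (hmin : (collocated A b).IsMinimal) (hbdom : b ∈ fracPowDomain A (1 / 2)) :
    (collocated A b).invariantZeros.Countable := by
  have hc : (⋃ n : ℕ, {μ ∈ (collocated A b).invariantZeros |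
      ∀ l, IsEigenvalue A l → 1 / ((n : ℝ) + 1) ≤ ‖μ - l‖}).Countable :=
    Set.countable_iUnion fun n =>
      (finite_zeros_away hA hspec hb hmin hbdom Nat.one_div_pos_of_nat).countable
  refine hc.mono fun μ hμ => ?_
  -- Each zero has positive distance from the spectrum, hence belongs to some set of the union.
  have hn : ∀ᶠ s in 𝓝 μ, s ∉ spec A := by
    have h1 : ∀ᶠ s in 𝓝 μ, s ≠ μ → s ∉ spec A := by
      have := hspec.not_accPt μ
      rw [accPt_iff_frequently, not_frequently] at this
      filter_upwards [this] with s hs hne hmem using hs ⟨hne, hmem⟩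
    filter_upwards [h1] with s hs
    rcases eq_or_ne s μ with rfl | hne
    · exact fun h => h (collocated_zeros_subset hmin hμ)
    · exact hs hne
  obtain ⟨δ, hδ, hball⟩ := Metric.eventually_nhds_iff.1 hn
  obtain ⟨n, hn⟩ := exists_nat_one_div_lt hδ
  refine Set.mem_iUnion.2 ⟨n, hμ, fun l hl => hn.le.trans (not_lt.1 fun hlt => ?_)⟩
  refine hball (y := l) ?_ hl.mem_spec
  rwa [dist_comm, dist_eq_norm]

end Asymptotics

theorem mainTheorem6 {Z : Type*} [NormedAddCommGroup Z] [InnerProductSpace ℂ Z] [CompleteSpace Z]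
    (A : Z →ₗ.[ℂ] Z) (b : Z)
    (hA : CollocatedSystems.IsSkewAdjoint A)
    (hspec : CollocatedSystems.HasDiscreteSpectrum A)
    (hb : b ≠ 0)
    (hmin : (CollocatedSystems.collocated A b).IsMinimal)
    (hbdom : b ∈ CollocatedSystems.fracPowDomain A (1 / 2)) :
    (CollocatedSystems.collocated A b).invariantZeros.Countable ∧
    (∀ μ : ℕ → ℂ, Function.Injective μ →
      Set.range μ = (CollocatedSystems.collocated A b).invariantZeros →
      ∀ ε : ℝ, 0 < ε → ∃ N : ℕ, ∀ n : ℕ, N ≤ n →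
        ∃ l : ℂ, CollocatedSystems.IsEigenvalue A l ∧ ‖μ n - l‖ < ε) ∧
    (CollocatedSystems.collocated A b).invariantZeros ⊆ CollocatedSystems.resolventSet A ∧
    Orthonormal ℂ (fun μ : (CollocatedSystems.collocated A b).invariantZeros =>
      ((‖CollocatedSystems.resolventOp A (μ : ℂ) b‖⁻¹ : ℝ) : ℂ) •
        CollocatedSystems.resolventOp A (μ : ℂ) b) := by
  have hskew := hA.isSkewSymmetric
  refine ⟨countable_zeros hskew hspec hb hmin hbdom, fun μ hinj hrange ε hε => ?_,
    collocated_zeros_subset hmin, orthonormal_zeros hskew hb hmin⟩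
  -- By injectivity only finitely many indices n give a zero at distance at least ε from every
  -- eigenvalue.
  have hfin := (finite_zeros_away hskew hspec hb hmin hbdom hε).preimage (hinj.injOn (s := _))
  obtain ⟨N, hN⟩ := hfin.bddAbove
  refine ⟨N + 1, fun n hn => ?_⟩
  by_contra! hcon
  exact absurd (hN (show n ∈ _ from ⟨hrange ▸ Set.mem_range_self n, hcon⟩)) (by omega)
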